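/- **Language.** Let $N$ be a finite set of agents and $\Theta$ a set of atomic propositions. Formulas are given by $$\phi ::= p \mid \neg\phi \mid \phi\wedge\phi \mid [H]\phi \mid K_i\phi \mid C_G\phi \mid D_G\phi,$$ where $p\in\Theta$, $i\in N$, $H\subseteq N$ and $\emptyset\neq G\subseteq N$. The connectives $\to,\leftrightarrow,\bot,\top$ are the usual classical abbreviations, $E_G\phi$ abbreviates $\bigwedge_{i\in G}K_i\phi$, and $D_i$ stands for $D_{\{i\}}$. **Axiom system $CLCD$.** The axioms are all instances of propositional tautologies and all instances of - $\neg[G]\bot$; $\ [G]\top$; $\ \neg[\emptyset]\neg\phi\to[N]\phi$; $\ [G](\phi\wedge\psi)\to[G]\psi$; $\ [G_1]\phi\wedge[G_2]\psi\to[G_1\cup G_2](\phi\wedge\psi)$ if $G_1\cap G_2=\emptyset$; - $K_i(\phi\to\psi)\to(K_i\phi\to K_i\psi)$; $\ K_i\phi\to\phi$; $\ K_i\phi\to K_iK_i\phi$; $\ \neg K_i\phi\to K_i\neg K_i\phi$; - $E_G\phi\leftrightarrow\bigwedge_{i\in G}K_i\phi$; $\ C_G\phi\to E_G(\phi\wedge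 C_G\phi)$; - $D_G(\phi\to\psi)\to(D_G\phi\to D_G\psi)$; $\ D_G\phi\to\phi$; $\ D_G\phi\to D_GD_G\phi$; $\ \neg D_G\phi\to D_G\neg D_G\phi$; $\ K_i\phi\leftrightarrow D_i\phi$; $\ D_G\phi\to D_H\phi$ if $G\subseteq H$. The rules are: modus ponens; from $\phi\leftrightarrow\psi$ infer $[G]\phi\leftrightarrow[G]\psi$; from $\phi$ infer $K_i\phi$; from $\phi\to E_G(\phi\wedge\psi)$ infer $\phi\to C_G\psi$. In all these, coalitions indexing $E$, $C$, $D$ are non-empty. A formula $\phi$ is *$CLCD$-consistent* if $\neg\phi$ is not derivable. **Pseudomodels.** A *pseudomodel* is a tuple $M=(S,\{\sim_i\}_{i\in N},\{R_G\}_{\emptyset\ne G\subseteq N},E,V)$ where $S$ is a non-empty set of states, $V(s)\subseteq\Theta$ for each $s\in S$, each $\sim_i$ and each $R_G$ is an equivalence relation on $S$, $R_{\{i\}}={\sim_i}$ for every $i\in N$, $G\subseteq H$ implies $R_H\subseteq R_G$, and $E$ assigns to each $s\in S$ and $G\subseteq N$ a set $E(G)(s)$ of subsets of $S$ such that, for all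 $s\in S$, $G,G_1,G_2\subseteq N$ and $X,Y\subseteq S$: - (E1) $\emptyset\notin E(G)(s)$; - (E2) $S\in E(G)(s)$; - (E3) if $S\setminus X\notin E(\emptyset)(s)$ then $X\in E(N)(s)$; - (E4) if $X\subseteq Y$ and $X\in E(G)(s)$ then $Y\in E(G)(s)$; - (E5) if $G_1\cap G_2=\emptyset$, $X\in E(G_1)(s)$ and $Y\in E(G_2)(s)$, then $X\cap Y\in E(G_1\cup G_2)(s)$; - (E6) $E(\emptyset)(s)$ has an element no proper subset of which belongs to $E(\emptyset)(s)$. The pseudomodel is *finite* if $S$ is finite. Truth at a state is defined by: $M,s\models p$ iff $p\in V(s)$; the usual clauses for $\neg$ and $\wedge$; $M,s\models[G]\phi$ iff $\{t\in S: M,t\models\phi\}\in E(G)(s)$; $M,s\models K_i\phi$ iff $M,t\models\phi$ for all $t$ with $s\sim_i t$; $M,s\models C_G\phi$ iff $M,t\models\phi$ for all $t$ with $(s,t)$ in the transitive closure of $\bigcup_{i\in G}\sim_i$; $M,s\models D_G\phi$ iff $M,t\models\phi$ for all $t$ with $s\,R_G\,t$. **Theorem.** For every $CLCD$-consistent formula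 $\phi$ there are a finite pseudomodel $M$ and a state $s$ of $M$ such that $M,s\models\phi$. -/

import Mathlib

namespace CLCD

/-- The non-empty coalitions, which index the group operators. -/
abbrev Coalition (N : Type*) := {G : Finset N // G.Nonempty}

/-- The coalition of one agent. -/
def Coalition.single {N : Type*} (i : N) : Coalition N := ⟨{i}, Finset.singleton_nonempty i⟩

/-- Formulas of coalition logic with individual, common and distributed knowledge, over the
agents `N` and the atomic propositions `Θ`. -/
inductive Formula (N : Type*) (Θ : Type*) where
  | atom (p : Θ)
  | neg (φ : Formula N Θ)
  | and (φ ψ : Formula N Θ)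
  | coal (G : Finset N) (φ : Formula N Θ)
  | know (i : N) (φ : Formula N Θ)
  | common (G : Coalition N) (φ : Formula N Θ)
  | dist (G : Coalition N) (φ : Formula N Θ)

namespace Formula

variable {N Θ : Type*}

/-- `φ → ψ`, that is `¬ (φ ∧ ¬ ψ)`. -/
def imp (φ ψ : Formula N Θ) : Formula N Θ := neg (and φ (neg ψ))

/-- `φ ↔ ψ`. -/
def iff (φ ψ : Formula N Θ) : Formula N Θ := and (imp φ ψ) (imp ψ φ)

/-- `⊥`, written with the help of a formula `χ` as `χ ∧ ¬ χ` (the language has no constant for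
falsity). -/
def bot (χ : Formula N Θ) : Formula N Θ := and χ (neg χ)

/-- `⊤`, written with the help of a formula `χ` as `¬ (χ ∧ ¬ χ)`. -/
def top (χ : Formula N Θ) : Formula N Θ := neg (bot χ)

/-- Everyone in `G` knows `φ`: the conjunction of the formulas `K_i φ` over `i ∈ G`. (The empty
list does not occur, as `G` is non-empty.) -/
noncomputable def everyone (G : Coalition N) (φ : Formula N Θ) : Formula N Θ :=
  match G.1.toList.map (fun i => know i φ) with
  | [] => top φ
  | a :: l => l.foldl and a

/-- Instances of propositional tautologies: the formulas that are true under every assignment of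
truth values to formulas that respects negation and conjunction. -/
def IsTautology (φ : Formula N Θ) : Prop :=
  ∀ v : Formula N Θ → Prop, (∀ ψ, v (neg ψ) ↔ ¬ v ψ) →
    (∀ ψ χ, v (and ψ χ) ↔ (v ψ ∧ v χ)) → v φ

end Formula

open Formula in
/-- Derivability in the axiom system `CLCD`. -/
inductive Provable {N Θ : Type*} [Fintype N] [DecidableEq N] : Formula N Θ → Prop
  | prop {φ} : IsTautology φ → Provable φ
  | G1 (G : Finset N) (χ) : Provable (neg (coal G (bot χ)))
  | G2 (G : Finset N) (χ) : Provable (coal G (top χ))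
  | G3 (φ) : Provable (imp (neg (coal ∅ (neg φ))) (coal Finset.univ φ))
  | G4 (G : Finset N) (φ ψ) : Provable (imp (coal G (and φ ψ)) (coal G ψ))
  | G5 (G₁ G₂ : Finset N) (φ ψ) : G₁ ∩ G₂ = ∅ →
      Provable (imp (and (coal G₁ φ) (coal G₂ ψ)) (coal (G₁ ∪ G₂) (and φ ψ)))
  | MP {φ ψ} : Provable φ → Provable (imp φ ψ) → Provable ψ
  | RG (G : Finset N) {φ ψ} : Provable (iff φ ψ) → Provable (iff (coal G φ) (coal G ψ))
  | K (i : N) (φ ψ) : Provable (imp (know i (imp φ ψ)) (imp (know i φ) (know i ψ)))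
  | T (i : N) (φ) : Provable (imp (know i φ) φ)
  | four (i : N) (φ) : Provable (imp (know i φ) (know i (know i φ)))
  | five (i : N) (φ) : Provable (imp (neg (know i φ)) (know i (neg (know i φ))))
  | RN (i : N) {φ} : Provable φ → Provable (know i φ)
  -- The axiom that unfolds `everyone` into its conjunction is an instance of `prop`,
  -- because `everyone` is an abbreviation for that conjunction.
  | C2 (G : Coalition N) (φ) :
      Provable (imp (common G φ) (everyone G (and φ (common G φ))))
  | RC (G : Coalition N) {φ ψ} : Provable (imp φ (everyone G (and φ ψ))) →
      Provable (imp φ (common G ψ))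
  | DK (G : Coalition N) (φ ψ) :
      Provable (imp (dist G (imp φ ψ)) (imp (dist G φ) (dist G ψ)))
  | DT (G : Coalition N) (φ) : Provable (imp (dist G φ) φ)
  | D4 (G : Coalition N) (φ) : Provable (imp (dist G φ) (dist G (dist G φ)))
  | D5 (G : Coalition N) (φ) : Provable (imp (neg (dist G φ)) (dist G (neg (dist G φ))))
  | D1 (i : N) (φ) : Provable (iff (know i φ) (dist (Coalition.single i) φ))
  | D2 (G H : Coalition N) (φ) : G.1 ⊆ H.1 → Provable (imp (dist G φ) (dist H φ))

/-- A formula is consistent if its negation is not derivable. -/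
def Consistent {N Θ : Type*} [Fintype N] [DecidableEq N] (φ : Formula N Θ) : Prop :=
  ¬ Provable (Formula.neg φ)

/-- Truly playable effectivity functions over the agents `N` and the states `S`. -/
structure TrulyPlayable {N S : Type*} [Fintype N] [DecidableEq N]
    (E : Finset N → Set (Set S)) : Prop where
  E1 : ∀ G, ∅ ∉ E G
  E2 : ∀ G, Set.univ ∈ E G
  E3 : ∀ X : Set S, Xᶜ ∉ E ∅ → X ∈ E Finset.univ
  E4 : ∀ G, ∀ X Y : Set S, X ⊆ Y → X ∈ E G → Y ∈ E G
  E5 : ∀ G₁ G₂, ∀ X Y : Set S, G₁ ∩ G₂ = ∅ → X ∈ E G₁ → Y ∈ E G₂ → X ∩ Y ∈ E (G₁ ∪ G₂)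
  E6 : ({X : Set S | X ∈ E ∅ ∧ ¬ ∃ Y, Y ∈ E ∅ ∧ Y ⊂ X}).Nonempty

/-- Epistemic coalition models with the set `S` of states. -/
structure Model (N Θ S : Type*) [Fintype N] [DecidableEq N] where
  nonempty : Nonempty S
  /-- the effectivity function at each state -/
  E : S → Finset N → Set (Set S)
  playable : ∀ s, TrulyPlayable (E s)
  /-- the epistemic accessibility relation of each agent -/
  acc : N → S → S → Prop
  acc_equiv : ∀ i, Equivalence (acc i)
  /-- the valuation -/
  V : S → Set Θ

/-- Pseudomodels: models with an additional family of relations for the non-empty coalitions. -/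
structure Pseudomodel (N Θ S : Type*) [Fintype N] [DecidableEq N] extends Model N Θ S where
  R : Coalition N → S → S → Prop
  R_equiv : ∀ G, Equivalence (R G)
  R_single : ∀ i s t, R (Coalition.single i) s t ↔ acc i s t
  R_anti : ∀ G H : Coalition N, G.1 ⊆ H.1 → ∀ s t, R H s t → R G s t

/-- Truth of a formula at a state of a pseudomodel. -/
def Pseudomodel.Sat {N Θ S : Type*} [Fintype N] [DecidableEq N] (M : Pseudomodel N Θ S) :
    S → Formula N Θ → Prop
  | s, .atom p => p ∈ M.V s
  | s, .neg φ => ¬ M.Sat s φ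
  | s, .and φ ψ => M.Sat s φ ∧ M.Sat s ψ
  | s, .coal G φ => {t | M.Sat t φ} ∈ M.E s G
  | s, .know i φ => ∀ t, M.acc i s t → M.Sat t φ
  | s, .common G φ =>
      ∀ t, Relation.TransGen (fun u w => ∃ i ∈ G.1, M.acc i u w) s t → M.Sat t φ
  | s, .dist G φ => ∀ t, M.R G s t → M.Sat t φ

end CLCD

/-! Filter the canonical model through a finite list `l` of formulas. Worlds are maximal consistent
sets, and states are the truth patterns on `l` that worlds realise, so there are finitely many; each
state gets one representative world. Every set of states `X` is defined by a formula `char X`, and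
`X` is effective for `G` at `s` when the representative satisfies `[G] char X`; the coalition axioms
then give playability.

`R_G` is agreement on the formulas `D_H α` of `l` with `H ⊆ G`: an equivalence, antitone in `G`, to
which canonical edges project (`World.Canon.rel`). Individual knowledge is treated as `D_{i}`. The
truth lemma `sat_filtration_iff` goes by induction on formulas; common knowledge needs the induction
rule applied to a formula `char X`. -/

namespace CLCD

open Formula

/-! ### The filtration set -/

section Closure

variable {N Θ : Type*}

/-- The formulas whose truth values decide `φ` in a filtration. -/
noncomputable def closure : Formula N Θ → List (Formula N Θ)
  | .atom p => [.atom p]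
  | .neg φ => .neg φ :: closure φ
  | .and φ ψ => .and φ ψ :: (closure φ ++ closure ψ)
  | .coal G φ => .coal G φ :: closure φ
  -- Accessibility only compares `D` formulas, so the `D_{i}` counterparts of `K_i φ`, and below the
  -- formulas `D_{i} C_G φ`, are added.
  | .know i φ => .know i φ :: .dist (Coalition.single i) φ :: closure φ
  | .common G φ => .common G φ ::
      (G.1.toList.map (fun i => .dist (Coalition.single i) (.common G φ)) ++ closure φ)
  | .dist G φ => .dist G φ :: closure φ

theorem self_mem_closure (φ : Formula N Θ) : φ ∈ closure φ := by
  cases φ <;> simp [closure]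

end Closure

/-! ### Maximal consistent sets and the canonical model -/

section Worlds

variable {N Θ : Type*} [Fintype N] [DecidableEq N]

/-- Derivability from premises, by modus ponens only. -/
inductive Derivable (Γ : Set (Formula N Θ)) : Formula N Θ → Prop
  | hyp {α} : α ∈ Γ → Derivable Γ α
  | provable {α} : Provable α → Derivable Γ α
  | mp {α β} : Derivable Γ α → Derivable Γ (imp α β) → Derivable Γ β

/-- Maximal consistent sets, as two-valued valuations that make every theorem true. -/
structure World (N Θ : Type*) [Fintype N] [DecidableEq N] where
  holds : Formula N Θ → Prop
  holds_neg : ∀ α, holds (neg α) ↔ ¬ holds α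
  holds_and : ∀ α β, holds (and α β) ↔ holds α ∧ holds β
  holds_of_provable : ∀ α, Provable α → holds α

theorem Derivable.mono {Γ Δ : Set (Formula N Θ)} (h : Γ ⊆ Δ) {α : Formula N Θ}
    (hα : Derivable Γ α) : Derivable Δ α := by
  induction hα with
  | hyp h' => exact .hyp (h h')
  | provable h' => exact .provable h'
  | mp _ _ ih₁ ih₂ => exact .mp ih₁ ih₂

theorem Derivable.taut {Γ : Set (Formula N Θ)} {α : Formula N Θ} (h : IsTautology α) :
    Derivable Γ α := .provable (.prop h)

theorem Derivable.deduction {Γ : Set (Formula N Θ)} {α β : Formula N Θ}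
    (h : Derivable (insert α Γ) β) : Derivable Γ (imp α β) := by
  have weaken : ∀ γ, Derivable Γ γ → Derivable Γ (imp α γ) := fun γ hγ =>
    .mp hγ (.taut fun v hn ha => by simp only [imp, hn, ha]; tauto)
  induction h with
  | @hyp γ h =>
    rcases h with rfl | h
    · exact .taut fun v hn ha => by simp only [imp, hn, ha]; tauto
    · exact weaken _ (.hyp h)
  | provable h => exact weaken _ (.provable h)
  | mp _ _ ih₁ ih₂ =>
    exact .mp ih₁ (.mp ih₂ (.taut fun v hn ha => by simp only [imp, hn, ha]; tauto))

/-- A derivation has finitely many premises, and a chain is directed. This provides the upper bounds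
for Zorn's lemma. -/
theorem Derivable.exists_of_sUnion {c : Set (Set (Formula N Θ))} (hc : IsChain (· ⊆ ·) c)
    (hne : c.Nonempty) {α : Formula N Θ} (h : Derivable (⋃₀ c) α) : ∃ Γ ∈ c, Derivable Γ α := by
  induction h with
  | hyp h =>
    obtain ⟨Γ, hΓ, h⟩ := h
    exact ⟨Γ, hΓ, .hyp h⟩
  | provable h =>
    obtain ⟨Γ, hΓ⟩ := hne
    exact ⟨Γ, hΓ, .provable h⟩
  | mp _ _ ih₁ ih₂ =>
    obtain ⟨Γ, hΓ, h₁⟩ := ih₁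
    obtain ⟨Δ, hΔ, h₂⟩ := ih₂
    rcases hc.total hΓ hΔ with h | h
    · exact ⟨Δ, hΔ, .mp (h₁.mono h) h₂⟩
    · exact ⟨Γ, hΓ, .mp h₁ (h₂.mono h)⟩

/-- Lindenbaum's lemma. -/
theorem exists_world {Γ : Set (Formula N Θ)} {α : Formula N Θ} (h : ¬ Derivable Γ α) :
    ∃ w : World N Θ, (∀ β ∈ Γ, w.holds β) ∧ ¬ w.holds α := by
  obtain ⟨Δ, hΓΔ, hΔ⟩ := zorn_subset_nonempty {Δ | ¬ Derivable Δ α}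
    (fun c hcs hc hne => ⟨⋃₀ c, fun hd => by
      obtain ⟨Γ', hΓ', hd'⟩ := hd.exists_of_sUnion hc hne
      exact hcs hΓ' hd', fun _ => Set.subset_sUnion_of_mem⟩) Γ h
  have hcon : ¬ Derivable Δ α := hΔ.prop
  -- `Δ` is maximal among the sets that do not derive `α`, so adding any new `β` makes `α`
  -- derivable.
  have imp_of : ∀ β, β ∉ Δ → Derivable Δ (imp β α) := fun β hβ => by
    by_contra hd
    exact hβ (hΔ.le_of_ge (y := insert β Δ) (fun h' => hd h'.deduction) (Set.subset_insert β Δ)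
      (Set.mem_insert β Δ))
  have closed : ∀ β, Derivable Δ β → β ∈ Δ := fun β hβ => by
    by_contra hn
    exact hcon (.mp hβ (imp_of β hn))
  refine ⟨⟨(· ∈ Δ), fun β => ⟨fun h₁ h₂ => hcon ?_, fun h₁ => ?_⟩, fun β γ => ⟨fun h' => ⟨?_, ?_⟩,
    fun h' => ?_⟩, fun β hβ => closed β (.provable hβ)⟩, fun β hβ => hΓΔ hβ,
    fun h' => hcon (.hyp h')⟩
  · exact .mp (.hyp h₂) (.mp (.hyp h₁) (.taut fun v hn ha => by simp only [imp, hn, ha]; tauto))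
  · by_contra h₂
    exact hcon (.mp (imp_of _ h₂) (.mp (imp_of _ h₁)
      (.taut fun v hn ha => by simp only [imp, hn, ha]; tauto)))
  · exact closed _ (.mp (.hyp h') (.taut fun v hn ha => by simp only [imp, hn, ha]; tauto))
  · exact closed _ (.mp (.hyp h') (.taut fun v hn ha => by simp only [imp, hn, ha]; tauto))
  · exact closed _ (.mp (.hyp h'.1) (.mp (.hyp h'.2)
      (.taut fun v hn ha => by simp only [imp, hn, ha]; tauto)))

/-- Lets derivability be checked semantically, in place of Hilbert-style derivations. -/
theorem provable_of_forall_world {α : Formula N Θ} (h : ∀ w : World N Θ, w.holds α) :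
    Provable α := by
  by_contra hα
  have : ¬ Derivable ∅ α := fun hd => hα <| by
    clear h hα
    induction hd with
    | hyp h => exact h.elim
    | provable h => exact h
    | mp _ _ ih₁ ih₂ => exact .MP ih₁ ih₂
  obtain ⟨w, -, hw⟩ := exists_world this
  exact hw (h w)

theorem Consistent.exists_world {φ : Formula N Θ} (h : Consistent φ) :
    ∃ w : World N Θ, w.holds φ := by
  by_contra! hw
  exact h (provable_of_forall_world fun w => (w.holds_neg φ).2 (hw w))

namespace World

theorem holds_imp (w : World N Θ) (α β : Formula N Θ) :
    w.holds (imp α β) ↔ (w.holds α → w.holds β) := by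
  simp only [imp, holds_neg, holds_and]; tauto

theorem holds_iff (w : World N Θ) (α β : Formula N Θ) :
    w.holds (iff α β) ↔ (w.holds α ↔ w.holds β) := by
  simp only [Formula.iff, holds_imp, holds_and]; tauto

theorem mp (w : World N Θ) {α β : Formula N Θ} (h : Provable (imp α β)) (hα : w.holds α) :
    w.holds β :=
  (w.holds_imp α β).1 (w.holds_of_provable _ h) hα

theorem holds_foldl_and (w : World N Θ) (l : List (Formula N Θ)) (α : Formula N Θ) :
    w.holds (l.foldl and α) ↔ w.holds α ∧ ∀ β ∈ l, w.holds β := by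
  induction l generalizing α with
  | nil => simp
  | cons β l ih => simp [ih, holds_and, and_assoc]

theorem holds_everyone (w : World N Θ) (G : Coalition N) (α : Formula N Θ) :
    w.holds (everyone G α) ↔ ∀ i ∈ G.1, w.holds (know i α) := by
  have hmem : ∀ i, i ∈ G.1 ↔ i ∈ G.1.toList := fun i => Finset.mem_toList.symm
  have hne : G.1.toList ≠ [] := by
    simpa [Finset.toList_eq_nil] using G.2.ne_empty
  simp only [hmem, everyone]
  cases hl : G.1.toList with
  | nil => exact absurd hl hne
  | cons i l => simp [holds_foldl_and]

theorem holds_know_iff (w : World N Θ) (i : N) (α : Formula N Θ) :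
    w.holds (know i α) ↔ w.holds (dist (Coalition.single i) α) :=
  (w.holds_iff _ _).1 (w.holds_of_provable _ (.D1 i α))

/-- Necessitation for `D_G` is not a rule: it comes from that for `K_i` with some `i ∈ G`, through
`D_{i}`. -/
theorem holds_dist_of_provable (w : World N Θ) (G : Coalition N) {α : Formula N Θ}
    (h : Provable α) : w.holds (dist G α) := by
  obtain ⟨i, hi⟩ := G.2
  exact w.mp (.D2 (Coalition.single i) G α (Finset.singleton_subset_iff.2 hi))
    ((w.holds_know_iff i α).1 (w.holds_of_provable _ (.RN i h)))

/-- The accessibility relation of the canonical model for distributed knowledge. -/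
def Canon (G : Coalition N) (w w' : World N Θ) : Prop :=
  ∀ α, w.holds (dist G α) → w'.holds α

theorem exists_canon (w : World N Θ) {G : Coalition N} {α : Formula N Θ}
    (h : ¬ w.holds (dist G α)) : ∃ w', Canon G w w' ∧ ¬ w'.holds α := by
  refine exists_world (Γ := {β | w.holds (dist G β)}) fun hd => h ?_
  clear h
  induction hd with
  | hyp h => exact h
  | provable h => exact w.holds_dist_of_provable G h
  | mp _ _ ih₁ ih₂ => exact (w.holds_imp _ _).1 (w.mp (.DK G _ _) ih₂) ih₁

/-- Positive and negative introspection for `H` put `D_H α` or its negation under `D_H`, hence under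
`D_G`, which the edge transmits. -/
theorem Canon.holds_dist_iff {G H : Coalition N} {w w' : World N Θ} (h : Canon G w w')
    (hHG : H.1 ⊆ G.1) (α : Formula N Θ) : w.holds (dist H α) ↔ w'.holds (dist H α) := by
  refine ⟨fun hα => h _ (w.mp (.D2 H G _ hHG) (w.mp (.D4 H α) hα)), fun hα => ?_⟩
  by_contra hn
  exact (w'.holds_neg _).1
    (h _ (w.mp (.D2 H G _ hHG) (w.mp (.D5 H α) ((w.holds_neg _).2 hn)))) hα

theorem holds_coal_congr (w : World N Θ) (G : Finset N) {α β : Formula N Θ}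
    (h : ∀ w' : World N Θ, w'.holds α ↔ w'.holds β) :
    w.holds (coal G α) ↔ w.holds (coal G β) :=
  (w.holds_iff _ _).1 <| w.holds_of_provable _ <| .RG G <|
    provable_of_forall_world fun w' => (w'.holds_iff _ _).2 (h w')

theorem holds_coal_mono (w : World N Θ) (G : Finset N) {α β : Formula N Θ}
    (h : ∀ w' : World N Θ, w'.holds α → w'.holds β) (hα : w.holds (coal G α)) :
    w.holds (coal G β) :=
  w.mp (.G4 G α β) <| (w.holds_coal_congr G fun w' => by
    rw [holds_and]; exact ⟨fun h' => ⟨h', h w' h'⟩, And.left⟩).1 hα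

theorem holds_common (w : World N Θ) {G : Coalition N} {i : N} (hi : i ∈ G.1) {α : Formula N Θ}
    (h : w.holds (common G α)) :
    w.holds α ∧ w.holds (dist (Coalition.single i) (common G α)) := by
  have hk := (w.holds_know_iff i _).1 ((w.holds_everyone G _).1 (w.mp (.C2 G α) h) i hi)
  refine ⟨((w.holds_and _ _).1 (w.mp (.DT _ _) hk)).1, ?_⟩
  by_contra hn
  obtain ⟨w', hw', hn'⟩ := w.exists_canon hn
  exact hn' ((w'.holds_and _ _).1 (hw' _ hk)).2

/-- The truth values of the formulas of the list `l` at a world. -/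
def type (l : List (Formula N Θ)) (w : World N Θ) : Set (Fin l.length) :=
  {k | w.holds (l.get k)}

theorem holds_iff_of_type_eq {l : List (Formula N Θ)} {w w' : World N Θ}
    (h : w.type l = w'.type l) {α : Formula N Θ} (hα : α ∈ l) : w.holds α ↔ w'.holds α := by
  obtain ⟨k, rfl⟩ := List.get_of_mem hα
  exact Set.ext_iff.1 h k

end World

/-! ### Characteristic formulas of types and of sets of types -/

theorem exists_char_type [Nonempty (Formula N Θ)] (l : List (Formula N Θ))
    (a : Set (Fin l.length)) : ∃ χ, ∀ w : World N Θ, w.holds χ ↔ w.type l = a := by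
  classical
  have key : ∀ s : Finset (Fin l.length), ∃ χ, ∀ w : World N Θ,
      w.holds χ ↔ ∀ k ∈ s, (w.holds (l.get k) ↔ k ∈ a) := fun s => by
    induction s using Finset.induction_on with
    | empty => exact ⟨top (Classical.arbitrary _), fun w => by
        simp [top, bot, World.holds_neg, World.holds_and]⟩
    | insert k s _ ih =>
      obtain ⟨χ, hχ⟩ := ih
      by_cases hk : k ∈ a
      · exact ⟨and (l.get k) χ, fun w => by
          simp only [World.holds_and, hχ, Finset.forall_mem_insert, hk, iff_true]⟩
      · exact ⟨and (neg (l.get k)) χ, fun w => by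
          simp only [World.holds_and, World.holds_neg, hχ, Finset.forall_mem_insert, hk,
            iff_false]⟩
  obtain ⟨χ, hχ⟩ := key Finset.univ
  refine ⟨χ, fun w => ?_⟩
  rw [hχ, Set.ext_iff]
  simp [World.type]

theorem exists_char [Nonempty (Formula N Θ)] (l : List (Formula N Θ))
    (X : Set (Set (Fin l.length))) : ∃ χ, ∀ w : World N Θ, w.holds χ ↔ w.type l ∈ X := by
  induction X, X.toFinite using Set.Finite.induction_on with
  | empty => exact ⟨bot (Classical.arbitrary _), fun w => by
      simp [bot, World.holds_neg, World.holds_and]⟩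
  | @insert a X _ _ ih =>
    obtain ⟨χ, hχ⟩ := ih
    obtain ⟨ξ, hξ⟩ := exists_char_type l a
    exact ⟨neg (and (neg ξ) (neg χ)), fun w => by
      simp only [World.holds_neg, World.holds_and, hχ, hξ, Set.mem_insert_iff]; tauto⟩

end Worlds

/-! ### The finite pseudomodel and the truth lemma -/

section Filtration

variable {N Θ : Type*} [Fintype N] [DecidableEq N]

/-- The states of the filtration through the list `l`. -/
abbrev State (l : List (Formula N Θ)) : Type := Set.range (World.type (N := N) (Θ := Θ) l)

/-- The type of a world, as a state. -/
def World.state (l : List (Formula N Θ)) (w : World N Θ) : State l := ⟨w.type l, w, rfl⟩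

/-- A world that represents a state. -/
noncomputable def State.world {l : List (Formula N Θ)} (s : State l) : World N Θ := s.2.choose

theorem State.type_world {l : List (Formula N Θ)} (s : State l) : s.world.type l = s.1 :=
  s.2.choose_spec

theorem World.holds_world_state {l : List (Formula N Θ)} (w : World N Θ) {α : Formula N Θ}
    (hα : α ∈ l) : (w.state l).world.holds α ↔ w.holds α :=
  World.holds_iff_of_type_eq (w.state l).type_world hα

/-- Agreement on the distributed knowledge of the subcoalitions of `G`, within `l`. -/
def State.Rel {l : List (Formula N Θ)} (G : Coalition N) (s t : State l) : Prop :=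
  ∀ H : Coalition N, H.1 ⊆ G.1 → ∀ α, dist H α ∈ l →
    (s.world.holds (dist H α) ↔ t.world.holds (dist H α))

theorem State.rel_equivalence {l : List (Formula N Θ)} (G : Coalition N) :
    Equivalence (State.Rel (l := l) G) where
  refl _ _ _ _ _ := Iff.rfl
  symm h H hH α hα := (h H hH α hα).symm
  trans h h' H hH α hα := (h H hH α hα).trans (h' H hH α hα)

theorem World.Canon.rel {l : List (Formula N Θ)} {G : Coalition N} {w w' : World N Θ}
    (h : World.Canon G w w') : State.Rel G (w.state l) (w'.state l) := fun H hH α hα => by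
  rw [World.holds_world_state _ hα, World.holds_world_state _ hα, h.holds_dist_iff hH]

/-- Distributed knowledge in a filtration, at a formula whose truth agrees with membership. -/
theorem State.forall_rel_iff {l : List (Formula N Θ)} {G : Coalition N} {φ : Formula N Θ}
    (hφ : φ ∈ l) (hd : dist G φ ∈ l) (s : State l) :
    (∀ t, State.Rel G s t → t.world.holds φ) ↔ s.world.holds (dist G φ) := by
  refine ⟨fun h => ?_, fun h t hst => t.world.mp (.DT G φ) ((hst G subset_rfl φ hd).1 h)⟩
  by_contra hn
  obtain ⟨w, hw, hwφ⟩ := s.world.exists_canon hn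
  have hs : s.world.state l = s := Subtype.ext s.type_world
  exact hwφ ((w.holds_world_state hφ).1 (h _ (hs ▸ hw.rel)))

variable [Nonempty (Formula N Θ)]

theorem exists_char_state (l : List (Formula N Θ)) (X : Set (State l)) :
    ∃ χ, ∀ w : World N Θ, w.holds χ ↔ w.state l ∈ X := by
  obtain ⟨χ, hχ⟩ := exists_char l (Subtype.val '' X)
  refine ⟨χ, fun w => ?_⟩
  rw [hχ]
  exact ⟨fun ⟨s, hs, h⟩ => (show w.state l = s from Subtype.ext h.symm) ▸ hs,
    fun h => ⟨_, h, rfl⟩⟩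

/-- A formula that characterizes a set of states. -/
noncomputable def char {l : List (Formula N Θ)} (X : Set (State l)) : Formula N Θ :=
  (exists_char_state l X).choose

theorem World.holds_char {l : List (Formula N Θ)} (X : Set (State l)) (w : World N Θ) :
    w.holds (char X) ↔ w.state l ∈ X :=
  (exists_char_state l X).choose_spec w

theorem State.holds_char {l : List (Formula N Θ)} (X : Set (State l)) (s : State l) :
    s.world.holds (char X) ↔ s ∈ X := by
  rw [World.holds_char, show s.world.state l = s from Subtype.ext s.type_world]

/-- Up to provable equivalence, `char` turns set operations into connectives, so E1–E5 mirror the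
coalition axioms. E6 holds because there are finitely many sets of states. -/
theorem trulyPlayable_char {l : List (Formula N Θ)} (w : World N Θ) :
    TrulyPlayable (fun G : Finset N => {X : Set (State l) | w.holds (coal G (char X))}) where
  E1 G h := by
    let χ : Formula N Θ := Classical.arbitrary _
    refine (w.holds_neg _).1 (w.holds_of_provable _ (.G1 G χ))
      ((w.holds_coal_congr G fun w' => ?_).1 h)
    simp [World.holds_char, bot, World.holds_and, World.holds_neg]
  E2 G := by
    let χ : Formula N Θ := Classical.arbitrary _
    refine (w.holds_coal_congr G fun w' => ?_).1 (w.holds_of_provable _ (.G2 G χ))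
    simp [World.holds_char, top, bot, World.holds_and, World.holds_neg]
  E3 X h := by
    refine w.mp (.G3 (char X)) ((w.holds_neg _).2 fun h' => h ?_)
    exact (w.holds_coal_congr ∅ fun w' => by
      simp [World.holds_char, World.holds_neg]).1 h'
  E4 G X Y hXY h := w.holds_coal_mono G (fun w' h' => by
    rw [World.holds_char] at h' ⊢; exact hXY h') h
  E5 G₁ G₂ X Y hG hX hY := by
    refine (w.holds_coal_congr _ fun w' => ?_).1
      (w.mp (.G5 G₁ G₂ _ _ hG) ((w.holds_and _ _).2 ⟨hX, hY⟩))
    simp [World.holds_char, World.holds_and]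
  E6 := by
    obtain ⟨X, hX⟩ := (Set.toFinite {X : Set (State l) | w.holds (coal ∅ (char X))}).exists_minimal
      ⟨Set.univ, by
        let χ : Formula N Θ := Classical.arbitrary _
        refine (w.holds_coal_congr ∅ fun w' => ?_).1 (w.holds_of_provable _ (.G2 ∅ χ))
        simp [World.holds_char, top, bot, World.holds_and, World.holds_neg]⟩
    exact ⟨X, hX.prop, fun ⟨Y, hY, hYX⟩ => hYX.2 (hX.le_of_le hY hYX.1)⟩

/-- The filtration of the canonical model through the list `l`. -/
noncomputable def filtration (l : List (Formula N Θ)) (w : World N Θ) :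
    Pseudomodel N Θ (State l) where
  nonempty := ⟨w.state l⟩
  -- Worlds of the same type may disagree on this formula, which need not lie in `l`; the chosen
  -- representative decides.
  E s G := {X | s.world.holds (coal G (char X))}
  playable s := trulyPlayable_char s.world
  acc i := State.Rel (Coalition.single i)
  acc_equiv _ := State.rel_equivalence _
  V s := {p | s.world.holds (atom p)}
  R := State.Rel
  R_equiv := State.rel_equivalence
  R_single _ _ _ := Iff.rfl
  R_anti _ _ hGH _ _ h K hK := h K (hK.trans hGH)

theorem State.forall_transGen_iff {l : List (Formula N Θ)} {G : Coalition N} {φ : Formula N Θ}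
    (hφ : φ ∈ l) (hc : common G φ ∈ l)
    (hd : ∀ i ∈ G.1, dist (Coalition.single i) (common G φ) ∈ l) (s : State l) :
    (∀ t, Relation.TransGen (fun u v => ∃ i ∈ G.1, State.Rel (Coalition.single i) u v) s t →
      t.world.holds φ) ↔ s.world.holds (common G φ) := by
  have hG := G.2
  constructor
  · intro h
    -- The reachable states form the invariant for the induction rule: `char X → E_G (φ ∧ char X)`
    -- holds at every world, since canonical successors project to `Rel`-successors.
    let X : Set (State l) :=
      {t | Relation.TransGen (fun u v => ∃ i ∈ G.1, State.Rel (Coalition.single i) u v) s t}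
    have hp : Provable (imp (char X) (common G φ)) := by
      refine .RC G (provable_of_forall_world fun w => ?_)
      rw [World.holds_imp, World.holds_everyone, World.holds_char]
      intro hw i hi
      rw [World.holds_know_iff]
      by_contra hn
      obtain ⟨w', hw', hn'⟩ := w.exists_canon hn
      have hX : w'.state l ∈ X := Relation.TransGen.tail hw ⟨i, hi, hw'.rel⟩
      exact hn' ((w'.holds_and _ _).2 ⟨(w'.holds_char X).2 hX,
        (w'.holds_world_state hφ).1 (h _ hX)⟩)
    obtain ⟨i, hi⟩ := hG
    -- `s` itself is in `X`: the transitive closure contains a loop at `s` because `G` is non-empty.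
    exact s.world.mp hp ((s.holds_char X).2
      (Relation.TransGen.single ⟨i, hi, (State.rel_equivalence _).refl s⟩))
  · intro h t hst
    obtain ⟨j, hj⟩ := hG
    suffices ht : t.world.holds (common G φ) from (t.world.holds_common hj ht).1
    have step : ∀ u v : State l, (∃ i ∈ G.1, State.Rel (Coalition.single i) u v) →
        u.world.holds (common G φ) → v.world.holds (common G φ) := by
      rintro u v ⟨i, hi, huv⟩ hu
      exact (State.forall_rel_iff hc (hd i hi) u).2 (u.world.holds_common hi hu).2 v huv
    induction hst with
    | single h' => exact step _ _ h' h
    | tail _ h' ih => exact step _ _ h' ih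

theorem sat_filtration_iff (l : List (Formula N Θ)) (w : World N Θ) (φ : Formula N Θ)
    (hφ : closure φ ⊆ l) (s : State l) : (filtration l w).Sat s φ ↔ s.world.holds φ := by
  have hmem : φ ∈ l := hφ (self_mem_closure φ)
  induction φ generalizing s with
  | atom p => rfl
  | neg φ ih =>
    simp only [closure, List.cons_subset] at hφ
    rw [Pseudomodel.Sat, World.holds_neg]
    exact not_congr (ih hφ.2 s (hφ.2 (self_mem_closure φ)))
  | and φ ψ ih₁ ih₂ =>
    simp only [closure, List.cons_subset, List.append_subset] at hφ
    rw [Pseudomodel.Sat, World.holds_and]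
    exact and_congr (ih₁ hφ.2.1 s (hφ.2.1 (self_mem_closure φ)))
      (ih₂ hφ.2.2 s (hφ.2.2 (self_mem_closure ψ)))
  | coal G φ ih =>
    simp only [closure, List.cons_subset] at hφ
    have hφl := hφ.2 (self_mem_closure φ)
    rw [Pseudomodel.Sat]
    simp only [fun t => ih hφ.2 t hφl]
    -- As `φ ∈ l`, the characteristic formula of its truth set agrees with `φ` at every world, not
    -- only at representatives.
    exact s.world.holds_coal_congr G fun w' => by
      rw [World.holds_char]; exact w'.holds_world_state hφl
  | know i φ ih =>
    simp only [closure, List.cons_subset] at hφ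
    have hφl := hφ.2.2 (self_mem_closure φ)
    rw [Pseudomodel.Sat, World.holds_know_iff]
    simp only [fun t => ih hφ.2.2 t hφl]
    exact State.forall_rel_iff hφl hφ.2.1 s
  | common G φ ih =>
    simp only [closure, List.cons_subset, List.append_subset] at hφ
    have hφl := hφ.2.2 (self_mem_closure φ)
    rw [Pseudomodel.Sat]
    simp only [fun t => ih hφ.2.2 t hφl]
    exact State.forall_transGen_iff hφl hφ.1 (fun i hi =>
      hφ.2.1 (List.mem_map.2 ⟨i, Finset.mem_toList.2 hi, rfl⟩)) s
  | dist G φ ih =>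
    simp only [closure, List.cons_subset] at hφ
    have hφl := hφ.2 (self_mem_closure φ)
    rw [Pseudomodel.Sat]
    simp only [fun t => ih hφ.2 t hφl]
    exact State.forall_rel_iff hφl hφ.1 s

end Filtration

end CLCD

theorem mainTheorem7 {N Θ : Type*} [Fintype N] [DecidableEq N]
    (φ : CLCD.Formula N Θ) (hφ : CLCD.Consistent φ) :
    ∃ (S : Type) (_ : Finite S) (M : CLCD.Pseudomodel N Θ S) (s : S), M.Sat s φ := by
  obtain ⟨w, hw⟩ := hφ.exists_world
  have : Nonempty (CLCD.Formula N Θ) := ⟨φ⟩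
  exact ⟨CLCD.State (CLCD.closure φ), inferInstance, CLCD.filtration (CLCD.closure φ) w,
    w.state _, (CLCD.sat_filtration_iff _ w φ (List.Subset.refl _) _).2
      ((w.holds_world_state (CLCD.self_mem_closure φ)).2 hw)⟩
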